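/- Let $D=\{x_k : k\ge 1\}$ be a set of traps, where $0<x_1<x_2<\cdots$ are integers. Consider the random walk $(X_n)_{n\ge 0}$ on $\{0,1,2,\dots\}\cup\{s\}$, where $s$ is a sink, with the following transition probabilities: the states $0$ and $s$ are absorbing; from a site $m\ge 1$ with $m\notin D$ the walk moves to $m-1$ or $m+1$ with probability $\tfrac12$ each; from a site $m\in D$ it moves to $m-1$, to $m+1$ or to $s$ with probability $\tfrac13$ each. Let $\tau=\inf\{n\ge 0 : X_n\in\{0,s\}\}\in[0,\infty]$. The system is called non-critical if $\mathbb E_m[\tau]<\infty$ for every starting site $m\ge 1$. Theorem. If $x_k=O(\rho^k)$ as $k\to\infty$ for some real number $\rho$ with $0<\rho<\dfrac{3+\sqrt5}{2}$, then the system is non-critical. -/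

import Mathlib

open scoped ENNReal
open MeasureTheory ProbabilityTheory

namespace TrappedWalk

/-- State space `{0, 1, 2, …} ∪ {s}` of the half-line walk. -/
inductive State where
  | sink : State
  | site (n : ℕ) : State

instance : MeasurableSpace State := ⊤

/-- One-step law of the half-line walk with trap set `D`. The sink `s` and the boundary point `0`
are absorbing. From a site `m ≥ 1` outside `D` the walker moves to `m - 1` or `m + 1` with
probability `1/2` each; from a site `m ≥ 1` in `D` it moves to `m - 1`, `m + 1` or `s` with
probability `1/3` each. -/
noncomputable def stepLaw (D : Set ℕ) : State → Measure State
  | .sink => Measure.dirac .sink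
  | .site 0 => Measure.dirac (.site 0)
  | .site (n + 1) =>
      open Classical in
      if n + 1 ∈ D then
        (3⁻¹ : ℝ≥0∞) • (Measure.dirac (.site n) + Measure.dirac (.site (n + 2))
          + Measure.dirac .sink)
      else
        (2⁻¹ : ℝ≥0∞) • (Measure.dirac (.site n) + Measure.dirac (.site (n + 2)))

theorem stepLaw_univ (D : Set ℕ) (z : State) : stepLaw D z Set.univ = 1 := by
  match z with
  | .sink => simp [stepLaw]
  | .site 0 => simp [stepLaw]
  | .site (n + 1) =>
      simp only [stepLaw]
      split_ifs
      · simp only [Measure.smul_apply, Measure.add_apply, measure_univ, smul_eq_mul]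
        rw [show (1 + 1 + 1 : ℝ≥0∞) = 3 by norm_num]
        exact ENNReal.inv_mul_cancel (by norm_num) (by norm_num)
      · simp only [Measure.smul_apply, Measure.add_apply, measure_univ, smul_eq_mul]
        rw [show (1 + 1 : ℝ≥0∞) = 2 by norm_num]
        exact ENNReal.inv_mul_cancel (by norm_num) (by norm_num)

/-- The transition kernel of the half-line walk with trap set `D`. -/
noncomputable def stepKernel (D : Set ℕ) : Kernel State State where
  toFun := stepLaw D
  measurable' := measurable_from_top

instance (D : Set ℕ) : IsMarkovKernel (stepKernel D) :=
  ⟨fun z => ⟨stepLaw_univ D z⟩⟩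

/-- The transition kernel as a kernel from histories up to time `n`: only the state at time `n`
is used. -/
noncomputable def historyKernel (D : Set ℕ) (n : ℕ) :
    Kernel ((i : Finset.Iic n) → (fun _ : ℕ => State) i) State :=
  (stepKernel D).comap (fun h => h ⟨n, Finset.mem_Iic.2 le_rfl⟩) (measurable_pi_apply _)

instance (D : Set ℕ) (n : ℕ) : IsMarkovKernel (historyKernel D n) :=
  inferInstanceAs (IsMarkovKernel ((stepKernel D).comap _ _))

/-- The law, on trajectories, of the half-line walk with trap set `D` started at `m`. -/
noncomputable def walkLaw (D : Set ℕ) (m : ℕ) : Measure (ℕ → State) :=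
  Kernel.traj (X := fun _ => State) (historyKernel D) 0 (fun _ => State.site m)

/-- `τ = inf {n ≥ 0 : Xₙ ∈ {0, s}}`, equal to `∞` if the trajectory never reaches `0` or `s`. -/
noncomputable def absorptionTime (X : ℕ → State) : ℝ≥0∞ :=
  ⨅ n ∈ {n : ℕ | X n = State.site 0 ∨ X n = State.sink}, (n : ℝ≥0∞)

/-- The half-line system with trap set `D` is non-critical if `E_m[τ] < ∞` for every starting
site `m ≥ 1`. -/
def NonCritical (D : Set ℕ) : Prop :=
  ∀ m : ℕ, 1 ≤ m → ∫⁻ X, absorptionTime X ∂(walkLaw D m) < ∞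

end TrappedWalk

/-! Let `h = harm` be the harmonic function of the killed walk and `s = slope` its increment. For
each `j`, `(2 / s j) * min (h n) (h (j + 1))` is superharmonic in `n`, losing at least 1 per step on
average at site `j + 1`. Summed over `j` it gives a Lyapunov function that drops by at least 1 at
every active site, so it bounds the mean absorption time (`lintegral_absorptionTime_le`); it is
finite as soon as `∑ 1 / s j` converges. At a trap `(h, s)` undergoes a linear map with top
eigenvalue `φ + 1 = (3 + √5) / 2`, so `s` is at least of order `(φ + 1) ^ k` past the `k`-th trap.
The gaps are `O(ρ ^ k)` with `ρ < φ + 1`, so `∑ 1 / s j` is dominated by a geometric series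
(`summable_inv_slope`). -/

namespace TrappedWalk

/-- The values at `n` of the harmonic function of the walk killed at traps, normalised by
`h 0 = 0`, `h 1 = 1`, and of its increment `h (n + 1) - h n`. -/
noncomputable def harmonicPair (D : Set ℕ) : ℕ → ℝ × ℝ
  | 0 => (0, 1)
  | n + 1 =>
      open Classical in
      ((harmonicPair D n).1 + (harmonicPair D n).2,
        (harmonicPair D n).2 +
          if n + 1 ∈ D then (harmonicPair D n).1 + (harmonicPair D n).2 else 0)

/-- The function vanishing at `0`, equal to `1` at `1` and harmonic for the walk killed at traps. -/
noncomputable def harm (D : Set ℕ) (n : ℕ) : ℝ := (harmonicPair D n).1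

/-- The increment `harm D (n + 1) - harm D n`. -/
noncomputable def slope (D : Set ℕ) (n : ℕ) : ℝ := (harmonicPair D n).2

/-! ### Harmonic function and Lyapunov function -/

section Harmonic

variable (D : Set ℕ)

theorem harm_zero : harm D 0 = 0 := rfl

theorem slope_zero : slope D 0 = 1 := rfl

theorem harm_succ (n : ℕ) : harm D (n + 1) = harm D n + slope D n := rfl

theorem slope_succ_of_mem {n : ℕ} (h : n + 1 ∈ D) :
    slope D (n + 1) = slope D n + harm D (n + 1) := by
  simp [slope, harm, harmonicPair, h]

theorem slope_succ_of_notMem {n : ℕ} (h : n + 1 ∉ D) : slope D (n + 1) = slope D n := by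
  simp [slope, harmonicPair, h]

theorem harm_nonneg_and_one_le_slope (n : ℕ) : 0 ≤ harm D n ∧ 1 ≤ slope D n := by
  induction n with
  | zero => simp [harm_zero, slope_zero]
  | succ n ih =>
    have h := harm_succ D n
    by_cases hn : n + 1 ∈ D
    · have := slope_succ_of_mem D hn
      constructor <;> linarith [ih.1, ih.2]
    · have := slope_succ_of_notMem D hn
      constructor <;> linarith [ih.1, ih.2]

theorem harm_nonneg (n : ℕ) : 0 ≤ harm D n := (harm_nonneg_and_one_le_slope D n).1

theorem slope_pos (n : ℕ) : 0 < slope D n :=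
  one_pos.trans_le (harm_nonneg_and_one_le_slope D n).2

theorem monotone_harm : Monotone (harm D) :=
  monotone_nat_of_le_succ fun n => by linarith [harm_succ D n, slope_pos D n]

theorem monotone_slope : Monotone (slope D) :=
  monotone_nat_of_le_succ fun n => by
    by_cases hn : n + 1 ∈ D
    · linarith [slope_succ_of_mem D hn, harm_nonneg D (n + 1)]
    · exact (slope_succ_of_notMem D hn).ge

/-- An upper bound for the Green function at `(n, j + 1)`. -/
noncomputable def green (j n : ℕ) : ℝ := 2 / slope D j * min (harm D n) (harm D (j + 1))

theorem green_nonneg (j n : ℕ) : 0 ≤ green D j n :=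
  mul_nonneg (div_nonneg zero_le_two (slope_pos D j).le)
    (le_min (harm_nonneg D n) (harm_nonneg D _))

theorem green_le (j n : ℕ) : green D j n ≤ 2 * harm D n * (slope D j)⁻¹ := by
  have h : green D j n ≤ 2 / slope D j * harm D n :=
    mul_le_mul_of_nonneg_left (min_le_left _ _) (div_nonneg zero_le_two (slope_pos D j).le)
  exact h.trans_eq (by ring)

/-- The three values of `green D j` around `n + 1`, up to the factor `c = 2 / slope D j`. -/
theorem green_cases (j n : ℕ) : ∃ c : ℝ, 0 ≤ c ∧ c * slope D j = 2 ∧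
    ((j ≠ n ∧ (∃ a, 0 ≤ a ∧ green D j n = c * a ∧ green D j (n + 1) = c * a ∧
        green D j (n + 2) = c * a)) ∨
      (j ≠ n ∧ green D j n = c * harm D n ∧ green D j (n + 1) = c * harm D (n + 1) ∧
        green D j (n + 2) = c * harm D (n + 2)) ∨
      (j = n ∧ green D j n = c * harm D n ∧ green D j (n + 1) = c * harm D (n + 1) ∧
        green D j (n + 2) = c * harm D (n + 1))) := by
  have hm := monotone_harm D
  refine ⟨2 / slope D j, div_nonneg zero_le_two (slope_pos D j).le,
    div_mul_cancel₀ _ (slope_pos D j).ne', ?_⟩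
  rcases lt_trichotomy j n with h | h | h
  · refine Or.inl ⟨h.ne, harm D (j + 1), harm_nonneg D _, ?_, ?_, ?_⟩ <;>
      rw [green, min_eq_right (hm (by omega))]
  · subst h
    refine Or.inr (Or.inr ⟨rfl, ?_, ?_, ?_⟩)
    · rw [green, min_eq_left (hm (by omega))]
    · rw [green, min_self]
    · rw [green, min_eq_right (hm (by omega))]
  · refine Or.inr (Or.inl ⟨h.ne', ?_, ?_, ?_⟩) <;>
      rw [green, min_eq_left (hm (by omega))]

/-- `green D j` is harmonic before its kink at `j + 1` and constant after it. At the kink the factor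
`2 / slope D j` makes the drop at least 1; off the traps it is exactly 1. -/
theorem green_of_mem (j : ℕ) {n : ℕ} (h : n + 1 ∈ D) :
    3⁻¹ * (green D j n + green D j (n + 2)) + (if j = n then 1 else 0) ≤ green D j (n + 1) := by
  have h1 := harm_succ D n
  have h2 : harm D (n + 2) = harm D (n + 1) + slope D (n + 1) := harm_succ D (n + 1)
  have h3 := slope_succ_of_mem D h
  obtain ⟨c, hc, hcs, ⟨hj, a, ha, e0, e1, e2⟩ | ⟨hj, e0, e1, e2⟩ | ⟨rfl, e0, e1, e2⟩⟩ :=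
    green_cases D j n
  · rw [if_neg hj, e0, e1, e2]
    linarith [mul_nonneg hc ha]
  · rw [if_neg hj, e0, e1, e2, h2, h3, h1]
    exact le_of_eq (by ring)
  · rw [if_pos rfl, e0, e1, e2, h1, mul_add c, hcs]
    linarith [mul_nonneg hc (harm_nonneg D j)]

theorem green_of_notMem (j : ℕ) {n : ℕ} (h : n + 1 ∉ D) :
    2⁻¹ * (green D j n + green D j (n + 2)) + (if j = n then 1 else 0) ≤ green D j (n + 1) := by
  have h1 := harm_succ D n
  have h2 : harm D (n + 2) = harm D (n + 1) + slope D (n + 1) := harm_succ D (n + 1)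
  have h3 := slope_succ_of_notMem D h
  obtain ⟨c, hc, hcs, ⟨hj, a, ha, e0, e1, e2⟩ | ⟨hj, e0, e1, e2⟩ | ⟨rfl, e0, e1, e2⟩⟩ :=
    green_cases D j n
  · rw [if_neg hj, e0, e1, e2]
    linarith
  · rw [if_neg hj, e0, e1, e2, h2, h3, h1]
    exact le_of_eq (by ring)
  · rw [if_pos rfl, e0, e1, e2, h1, mul_add c, hcs]
    linarith

/-- A Lyapunov function for the walk: the sum over all sites of `green`. -/
noncomputable def lyapunov : State → ℝ≥0∞
  | .sink => 0
  | .site n => ∑' j, ENNReal.ofReal (green D j n)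

theorem lyapunov_lt_top (h : Summable fun j => (slope D j)⁻¹) (n : ℕ) :
    lyapunov D (.site n) < ∞ := by
  have hs : Summable fun j => green D j n :=
    Summable.of_nonneg_of_le (fun j => green_nonneg D j n) (fun j => green_le D j n)
      (h.mul_left _)
  rw [lyapunov, ← ENNReal.ofReal_tsum_of_nonneg (fun j => green_nonneg D j n) hs]
  exact ENNReal.ofReal_lt_top

theorem mul_tsum_green_add_one_le {r : ℝ} (hr : 0 ≤ r) {n : ℕ}
    (h : ∀ j, r * (green D j n + green D j (n + 2)) + (if j = n then 1 else 0)
      ≤ green D j (n + 1)) :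
    ENNReal.ofReal r * (lyapunov D (.site n) + lyapunov D (.site (n + 2))) + 1
      ≤ lyapunov D (.site (n + 1)) := by
  have h1 : (1 : ℝ≥0∞) = ∑' j : ℕ, if j = n then 1 else 0 := (tsum_ite_eq n fun _ => 1).symm
  simp only [lyapunov]
  rw [h1, ← ENNReal.tsum_add, ← ENNReal.tsum_mul_left, ← ENNReal.tsum_add]
  refine ENNReal.tsum_le_tsum fun j => ?_
  have e : (if j = n then 1 else 0 : ℝ≥0∞) = ENNReal.ofReal (if j = n then 1 else 0) := by
    split_ifs <;> simp
  have hg := add_nonneg (green_nonneg D j n) (green_nonneg D j (n + 2))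
  rw [e, ← ENNReal.ofReal_add (green_nonneg D j n) (green_nonneg D j (n + 2)),
    ← ENNReal.ofReal_mul hr, ← ENNReal.ofReal_add (mul_nonneg hr hg) (by split_ifs <;> simp)]
  exact ENNReal.ofReal_le_ofReal (h j)

theorem lintegral_lyapunov_add_one_le (n : ℕ) :
    ∫⁻ z, lyapunov D z ∂(stepLaw D (.site (n + 1))) + 1 ≤ lyapunov D (.site (n + 1)) := by
  have hm : Measurable (lyapunov D) := measurable_from_top
  by_cases h : n + 1 ∈ D
  · have := mul_tsum_green_add_one_le D (r := 3⁻¹) (by norm_num) fun j => green_of_mem D j h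
    rw [ENNReal.ofReal_inv_of_pos (by norm_num), ENNReal.ofReal_ofNat] at this
    simp only [stepLaw, if_pos h, lintegral_smul_measure, lintegral_add_measure,
      lintegral_dirac' _ hm, smul_eq_mul]
    simpa [lyapunov] using this
  · have := mul_tsum_green_add_one_le D (r := 2⁻¹) (by norm_num) fun j => green_of_notMem D j h
    rw [ENNReal.ofReal_inv_of_pos (by norm_num), ENNReal.ofReal_ofNat] at this
    simpa only [stepLaw, if_neg h, lintegral_smul_measure, lintegral_add_measure,
      lintegral_dirac' _ hm, smul_eq_mul] using this

end Harmonic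

/-! ### From the drift inequality to the expected absorption time -/

section Markov

variable (D : Set ℕ)

/-- The states at which the walk is not absorbed. -/
def activeSites : Set State := {z | ¬ (z = State.site 0 ∨ z = State.sink)}

theorem lintegral_lyapunov_add_indicator_le (z : State) :
    ∫⁻ w, lyapunov D w ∂(stepLaw D z) + activeSites.indicator 1 z ≤ lyapunov D z := by
  have hm : Measurable (lyapunov D) := measurable_from_top
  match z with
  | .sink => simp [stepLaw, lintegral_dirac' _ hm, activeSites]
  | .site 0 => simp [stepLaw, lintegral_dirac' _ hm, activeSites]
  | .site (n + 1) =>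
    rw [Set.indicator_of_mem (by simp [activeSites])]
    exact lintegral_lyapunov_add_one_le D n

/-- The Markov property: split the trajectory law at time `n`. -/
theorem lintegral_walkLaw_succ (m n : ℕ) (f : State → ℝ≥0∞) :
    ∫⁻ X, f (X (n + 1)) ∂(walkLaw D m) =
      ∫⁻ X, ∫⁻ w, f w ∂(stepLaw D (X n)) ∂(walkLaw D m) := by
  have hf : Measurable f := measurable_from_top
  have hg : Measurable fun z => ∫⁻ w, f w ∂(stepLaw D z) := measurable_from_top
  rw [walkLaw]
  conv_lhs => rw [← Kernel.traj_comp_partialTraj (zero_le (a := n))]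
  have hfn : Measurable fun X : ℕ → State => f (X (n + 1)) := hf.comp (measurable_pi_apply _)
  have hgn : Measurable fun y : ((i : Finset.Iic n) → (fun _ : ℕ => State) i) =>
      ∫⁻ w, f w ∂(stepLaw D (y ⟨n, Finset.mem_Iic.2 le_rfl⟩)) := hg.comp (measurable_pi_apply _)
  rw [Kernel.lintegral_comp _ _ _ hfn]
  have key : ∀ y : ((i : Finset.Iic n) → (fun _ : ℕ => State) i),
      ∫⁻ X, f (X (n + 1)) ∂(Kernel.traj (X := fun _ => State) (historyKernel D) n y) =
        ∫⁻ w, f w ∂(stepLaw D (y ⟨n, Finset.mem_Iic.2 le_rfl⟩)) := fun y => by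
    rw [← lintegral_map (μ := Kernel.traj (X := fun _ => State) (historyKernel D) n y) hf
      (measurable_pi_apply (n + 1)), ← Kernel.map_apply _ (measurable_pi_apply (n + 1)),
      Kernel.map_traj_succ_self]
    rfl
  simp_rw [key]
  rw [← Kernel.traj_map_frestrictLe, Kernel.map_apply _ (Preorder.measurable_frestrictLe n),
    lintegral_map hgn (Preorder.measurable_frestrictLe n)]
  rfl

theorem lintegral_walkLaw_zero (m : ℕ) (f : State → ℝ≥0∞) :
    ∫⁻ X, f (X 0) ∂(walkLaw D m) = f (.site m) := by
  have hf : Measurable f := measurable_from_top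
  have hf' : Measurable fun y : ((i : Finset.Iic 0) → (fun _ : ℕ => State) i) =>
      f (y ⟨0, Finset.mem_Iic.2 le_rfl⟩) := hf.comp (measurable_pi_apply _)
  have h := lintegral_map (μ := walkLaw D m) hf' (Preorder.measurable_frestrictLe 0)
  rw [walkLaw, Kernel.traj_map_frestrictLe_apply, Kernel.partialTraj_self, Kernel.id_apply,
    lintegral_dirac' _ hf'] at h
  exact h.symm

/-- Dynkin's inequality: the one-step drift bound telescopes. -/
theorem sum_lintegral_indicator_add_le (m N : ℕ) :
    ∑ n ∈ Finset.range N, ∫⁻ X, activeSites.indicator 1 (X n) ∂(walkLaw D m) +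
      ∫⁻ X, lyapunov D (X N) ∂(walkLaw D m) ≤ lyapunov D (.site m) := by
  induction N with
  | zero => simp [lintegral_walkLaw_zero D m]
  | succ N ih =>
    refine le_trans ?_ ih
    have hg : Measurable fun z => ∫⁻ w, lyapunov D w ∂(stepLaw D z) := measurable_from_top
    have hgN : Measurable fun X : ℕ → State => ∫⁻ w, lyapunov D w ∂(stepLaw D (X N)) :=
      hg.comp (measurable_pi_apply N)
    rw [Finset.sum_range_succ, lintegral_walkLaw_succ, add_assoc, add_comm (∫⁻ X, _ ∂_),
      ← lintegral_add_left hgN]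
    gcongr with X
    exact lintegral_lyapunov_add_indicator_le D (X N)

theorem absorptionTime_le_tsum (X : ℕ → State) :
    absorptionTime X ≤ ∑' n, activeSites.indicator 1 (X n) := by
  classical
  by_cases h : ∃ n, X n = State.site 0 ∨ X n = State.sink
  · refine (iInf₂_le (Nat.find h) (Nat.find_spec h)).trans ?_
    refine le_trans (le_of_eq ?_) (ENNReal.sum_le_tsum (Finset.range (Nat.find h)))
    rw [Finset.sum_congr rfl fun n hn =>
      Set.indicator_of_mem (s := activeSites) (Nat.find_min h (Finset.mem_range.1 hn)) 1]
    simp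
  · push Not at h
    have : ∀ n, activeSites.indicator (1 : State → ℝ≥0∞) (X n) = 1 := fun n =>
      Set.indicator_of_mem (s := activeSites) (by simpa [activeSites] using h n) 1
    simp [this]

theorem lintegral_absorptionTime_le (m : ℕ) :
    ∫⁻ X, absorptionTime X ∂(walkLaw D m) ≤ lyapunov D (.site m) := by
  have hm : Measurable (activeSites.indicator (1 : State → ℝ≥0∞)) := measurable_from_top
  have hmn : ∀ n, AEMeasurable
      (fun X : ℕ → State => activeSites.indicator (1 : State → ℝ≥0∞) (X n)) (walkLaw D m) :=
    fun n => (hm.comp (measurable_pi_apply n)).aemeasurable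
  refine (lintegral_mono absorptionTime_le_tsum).trans ?_
  rw [lintegral_tsum hmn]
  exact ENNReal.tsum_le_of_sum_range_le fun N =>
    le_self_add.trans (sum_lintegral_indicator_add_le D m N)

end Markov

/-! ### Exponential growth of the slope along the traps -/

section Growth

open Real

variable (D : Set ℕ)

theorem monotone_harm_add_slope : Monotone fun n => harm D n + goldenRatio * slope D n :=
  (monotone_harm D).add ((monotone_slope D).const_mul goldenRatio_pos.le)

/-- A trap acts by `(h, s) ↦ (h + s, h + 2 * s)`, and `(1, φ)` is a left eigenvector because `φ ^ 2
= φ + 1`. -/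
theorem harm_add_slope_of_mem {n : ℕ} (h : n + 1 ∈ D) :
    harm D (n + 1) + goldenRatio * slope D (n + 1) =
      (goldenRatio + 1) * (harm D n + goldenRatio * slope D n) := by
  rw [slope_succ_of_mem D h, harm_succ]
  linear_combination (-slope D n) * goldenRatio_sq

theorem pow_le_slope_of_mem {x : ℕ → ℕ} (hx1 : 0 < x 1) (hx : ∀ k, 1 ≤ k → x k < x (k + 1))
    (hD : ∀ k, 1 ≤ k → x k ∈ D) (k : ℕ) : (goldenRatio + 1) ^ k ≤ slope D (x (k + 1)) := by
  have hpos : (0 : ℝ) < goldenRatio + 1 := by linarith [goldenRatio_pos]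
  have key : ∀ k, (goldenRatio + 1) ^ (k + 1) ≤
      harm D (x (k + 1)) + goldenRatio * slope D (x (k + 1)) := fun k => by
    induction k with
    | zero =>
      obtain ⟨n, hn⟩ : ∃ n, x 1 = n + 1 := ⟨x 1 - 1, by omega⟩
      have h0 := monotone_harm_add_slope D (Nat.zero_le n)
      simp only [harm_zero, slope_zero] at h0
      rw [zero_add, hn, harm_add_slope_of_mem D (hn ▸ hD 1 le_rfl), pow_one]
      exact le_mul_of_one_le_right hpos.le (by linarith [one_lt_goldenRatio])
    | succ k ih =>
      have hlt : x (k + 1) < x (k + 2) := hx (k + 1) (by omega)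
      obtain ⟨n, hn⟩ : ∃ n, x (k + 2) = n + 1 := ⟨x (k + 2) - 1, by omega⟩
      have h0 := monotone_harm_add_slope D (show x (k + 1) ≤ n by omega)
      rw [show k + 1 + 1 = k + 2 from rfl, hn,
        harm_add_slope_of_mem D (hn ▸ hD (k + 2) (by omega)), pow_succ']
      exact mul_le_mul_of_nonneg_left (ih.trans h0) hpos.le
  -- Thus `h + φ * s ≤ (φ + 1) * s` at a trap; cancelling `φ + 1` costs one power.
  have hle : harm D (x (k + 1)) ≤ slope D (x (k + 1)) := by
    have : 0 < x (k + 1) := by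
      rcases k with _ | k
      · exact hx1
      · exact Nat.zero_lt_of_lt (hx (k + 1) (by omega))
    obtain ⟨n, hn⟩ : ∃ n, x (k + 1) = n + 1 := ⟨x (k + 1) - 1, by omega⟩
    rw [hn, slope_succ_of_mem D (hn ▸ hD (k + 1) (by omega))]
    linarith [slope_pos D n]
  refine le_of_mul_le_mul_left ?_ hpos
  rw [← pow_succ']
  linarith [key k]

theorem summable_inv_slope {x : ℕ → ℕ} (hx1 : 0 < x 1) (hx : ∀ k, 1 ≤ k → x k < x (k + 1))
    (hD : ∀ k, 1 ≤ k → x k ∈ D) {ρ : ℝ} (hρ0 : 0 < ρ) (hρ : ρ < goldenRatio + 1)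
    (hO : (fun k : ℕ => (x k : ℝ)) =O[Filter.atTop] (fun k : ℕ => ρ ^ k)) :
    Summable fun j => (slope D j)⁻¹ := by
  have hpos : (0 : ℝ) < goldenRatio + 1 := by linarith [goldenRatio_pos]
  obtain ⟨C, hC, hb⟩ := Asymptotics.bound_of_isBigO_nat_atTop hO
  have hxC : ∀ k, (x k : ℝ) ≤ C * ρ ^ k := fun k => by
    have := hb (x := k) (pow_pos hρ0 k).ne'
    rwa [norm_natCast, norm_of_nonneg (pow_pos hρ0 k).le] at this
  set r := ρ / (goldenRatio + 1) with hr
  have hr0 : 0 ≤ r := (div_pos hρ0 hpos).le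
  have hr1 : r < 1 := (div_lt_one hpos).2 hρ
  have hinv : ∀ j, 0 ≤ (slope D j)⁻¹ := fun j => (inv_pos.2 (slope_pos D j)).le
  -- Between consecutive traps: at most `C * ρ ^ (k + 2)` terms, each at most `(φ + 1) ^ (-k)`.
  have hblock : ∀ k, ∑ j ∈ Finset.Ico (x (k + 1)) (x (k + 2)), (slope D j)⁻¹ ≤
      C * ρ ^ 2 * r ^ k := fun k => by
    have h1 : ∀ j ∈ Finset.Ico (x (k + 1)) (x (k + 2)),
        (slope D j)⁻¹ ≤ ((goldenRatio + 1) ^ k)⁻¹ := fun j hj =>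
      inv_anti₀ (pow_pos hpos k) ((pow_le_slope_of_mem D hx1 hx hD k).trans
        (monotone_slope D (Finset.mem_Ico.1 hj).1))
    refine (Finset.sum_le_card_nsmul _ _ _ h1).trans ?_
    rw [Nat.card_Ico, nsmul_eq_mul]
    have h2 : ((x (k + 2) - x (k + 1) : ℕ) : ℝ) ≤ C * ρ ^ (k + 2) :=
      (Nat.cast_le.2 (Nat.sub_le _ _)).trans (hxC (k + 2))
    refine (mul_le_mul_of_nonneg_right h2 (inv_pos.2 (pow_pos hpos k)).le).trans_eq ?_
    rw [hr, div_pow, pow_add]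
    ring
  have hsum : ∀ k, ∑ j ∈ Finset.range (x (k + 1)), (slope D j)⁻¹ ≤
      ∑ j ∈ Finset.range (x 1), (slope D j)⁻¹ +
        ∑ i ∈ Finset.range k, C * ρ ^ 2 * r ^ i := fun k => by
    induction k with
    | zero => simp
    | succ k ih =>
      rw [← Finset.sum_range_add_sum_Ico _ (hx (k + 1) (by omega)).le, Finset.sum_range_succ]
      linarith [hblock k]
  have hgeom : Summable fun i => C * ρ ^ 2 * r ^ i :=
    (summable_geometric_of_lt_one hr0 hr1).mul_left _
  have hxk : ∀ k, k ≤ x (k + 1) := fun k => by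
    induction k with
    | zero => exact Nat.zero_le _
    | succ k ih => exact Nat.succ_le_of_lt (ih.trans_lt (hx (k + 1) (by omega)))
  refine summable_of_sum_range_le hinv (c := ∑ j ∈ Finset.range (x 1), (slope D j)⁻¹ +
    ∑' i, C * ρ ^ 2 * r ^ i) fun k => ?_
  refine (Finset.sum_le_sum_of_subset_of_nonneg (Finset.range_mono (hxk k))
    fun j _ _ => hinv j).trans ((hsum k).trans ?_)
  gcongr
  exact hgeom.sum_le_tsum _ fun i _ => by positivity

end Growth

end TrappedWalk

theorem mainTheorem4 (x : ℕ → ℕ) (hx1 : 0 < x 1) (hx : ∀ k, 1 ≤ k → x k < x (k + 1))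
    (ρ : ℝ) (hρ0 : 0 < ρ) (hρ : ρ < (3 + Real.sqrt 5) / 2)
    (hO : (fun k : ℕ => (x k : ℝ)) =O[Filter.atTop] (fun k : ℕ => ρ ^ k)) :
    TrappedWalk.NonCritical {d : ℕ | ∃ k, 1 ≤ k ∧ x k = d} := by
  intro m _
  have hφ : (3 + Real.sqrt 5) / 2 = Real.goldenRatio + 1 := by
    rw [Real.goldenRatio]
    ring
  have hD : ∀ k, 1 ≤ k → x k ∈ {d : ℕ | ∃ k, 1 ≤ k ∧ x k = d} := fun k hk => ⟨k, hk, rfl⟩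
  exact (TrappedWalk.lintegral_absorptionTime_le _ m).trans_lt
    (TrappedWalk.lyapunov_lt_top _
      (TrappedWalk.summable_inv_slope _ hx1 hx hD hρ0 (hρ.trans_eq hφ) hO) m)
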